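/- Let $\mathcal D_0$ be the set of Dirichlet series $\sum_{n\ge 2} c_n n^{-s}$ with complex coefficients that converge absolutely in some half-plane, and write $\sigma_a^h\in[-\infty,\infty)$ for the abscissa of absolute convergence of $h\in\mathcal D_0$. Let $f=\sum_{n\ge 2} c_n n^{-s}\in\mathcal D_0$ have nonnegative coefficients $c_n$ and $\sigma_a^f>-\infty$, and let $w>0$. Then there is a unique $g\in\mathcal D_0$ such that $f(s-wg(s))=g(s)$ for all $s$ in some half-plane $\operatorname{Re}(s)>\theta$. This $g$ has nonnegative coefficients, and $$\sigma_a^g=\min_{s\ge\sigma_a^f}\bigl(s+wf(s)\bigr),$$ where $s$ is real, $f(\sigma_a^f):=+\infty$ if the series $f$ diverges at $\sigma_a^f$, and the minimum is attained. Moreover, the limit $f'(\sigma_a^f+):=\lim_{s\downarrow\sigma_a^f}f'(s)$ exists as an extended real number (possibly $-\infty$), and: (i) if $f'(\sigma_a^f+)<-1/w$, then the equation $f'(s)=-1/w$ has a unique solution $s_0$ in $(\sigma_a^f,\infty)$, and $\sigma_a^g=s_0+wf(s_0)$; (ii) if $f'(\sigma_a^f+)\ge-1/w$, then the series $f$ converges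 absolutely at $\sigma_a^f$, and $\sigma_a^g=\sigma_a^f+wf(\sigma_a^f)$. -/

import Mathlib

open Filter Topology
open scoped ComplexOrder

/-- The class `𝒟₀`: Dirichlet series `∑ c_n n^{-s}` (given by their coefficients) with `c_1 = 0` which
converge absolutely in some half-plane. -/
structure IsDirichletD0 (c : ArithmeticFunction ℂ) : Prop where
  one_eq_zero : c 1 = 0
  abscissa_lt_top : LSeries.abscissaOfAbsConv c < ⊤

/-- `g ∈ 𝒟₀` solves `f (s - w g(s)) = g(s)`: in some half-plane `θ < Re s` both series converge
absolutely at the relevant points and the identity holds. -/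
structure SolvesInversion (f : ArithmeticFunction ℂ) (w : ℝ) (g : ArithmeticFunction ℂ) : Prop where
  mem : IsDirichletD0 g
  eqn : ∃ θ : ℝ, ∀ s : ℂ, θ < s.re →
    LSeriesSummable g s ∧ LSeriesSummable f (s - w * LSeries g s) ∧
      LSeries f (s - w * LSeries g s) = LSeries g s

/-- The sum of the Dirichlet series at a real point, as a real number (the series has real
coefficients wherever this is used). -/
noncomputable def realSum (f : ArithmeticFunction ℂ) (s : ℝ) : ℝ := (LSeries f (s : ℂ)).re

open Classical in
/-- The sum of a Dirichlet series with nonnegative coefficients at a real point, as an element of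
`[0, +∞]`: it is `+∞` where the series diverges. -/
noncomputable def extendedSum (f : ArithmeticFunction ℂ) (s : ℝ) : EReal :=
  if LSeriesSummable f (s : ℂ) then (realSum f s : EReal) else ⊤

open scoped ENNReal

namespace DirichletInversion

/-! Expanding `n ^ (w z) = exp (w z log n)` turns `f (s - w g(s))` into a power series in `g`, hence
into an operation `subst` on coefficients (`LSeries_subst`). As `c 1 = 0`, the `n`-th coefficient of
`subst w c b` involves only `b d` with `d < n`, so `subst w c` has exactly one fixed point,
`solution`; uniqueness of Dirichlet coefficients makes it the only `g` (`eq_solution`). With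
nonnegative coefficients nothing cancels and the substitution identity holds in `[0, ∞]`
(`lnorm_subst_of_nonneg`). It follows that `g` converges at a real `s` exactly when `s = u + w f(u)`
for some real `u` where `f` converges: `u = s - w g(s)` in one direction, a bound on the iterates by
`f(u)` in the other. The abscissa of `g` is therefore the least value of `u + w f(u)`. On the real
axis `f` is convex with strictly increasing derivative, so this minimum lies at the critical point
`f' = -1/w` if there is one, and otherwise at the abscissa of `f`. -/

/-! ### Composition of Dirichlet series at the level of coefficients -/

/-- The coefficients of the `k`-th term of `f (s - w z) = ∑ₖ (∑ₙ (w log n)ᵏ / k! f(n) n⁻ˢ) zᵏ`. -/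
noncomputable def logExp (w : ℝ) (c : ArithmeticFunction ℂ) (k : ℕ) : ArithmeticFunction ℂ :=
  ⟨fun n => (((w * Real.log n) ^ k / k.factorial : ℝ) : ℂ) * c n, by simp⟩

lemma logExp_apply (w : ℝ) (c : ArithmeticFunction ℂ) (k n : ℕ) :
    logExp w c k n = (((w * Real.log n) ^ k / k.factorial : ℝ) : ℂ) * c n := rfl

/-- The coefficients of the Dirichlet series `f (s - w g(s))`, when `g` has no constant term. -/
noncomputable def subst (w : ℝ) (c b : ArithmeticFunction ℂ) : ArithmeticFunction ℂ :=
  ⟨fun n => ∑ k ∈ Finset.range (n + 1), (logExp w c k * b ^ k) n, by simp⟩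

lemma subst_apply (w : ℝ) (c b : ArithmeticFunction ℂ) (n : ℕ) :
    subst w c b n = ∑ k ∈ Finset.range (n + 1), (logExp w c k * b ^ k) n := rfl

lemma pow_apply_eq_zero {b : ArithmeticFunction ℂ} (hb : b 1 = 0) (k : ℕ) {n : ℕ}
    (hn : n < 2 ^ k) : (b ^ k) n = 0 := by
  induction k generalizing n with
  | zero => obtain rfl : n = 0 := by simpa using hn
            simp
  | succ k ih =>
    rw [pow_succ, ArithmeticFunction.mul_apply]
    refine Finset.sum_eq_zero fun p hp => ?_
    obtain ⟨hp, hn0⟩ := Nat.mem_divisorsAntidiagonal.1 hp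
    rcases Nat.lt_or_ge p.2 2 with h | h
    · interval_cases h2 : p.2 <;> simp [hb]
    · rw [ih, zero_mul]
      rw [pow_succ] at hn
      by_contra! h'
      exact absurd (Nat.mul_le_mul h' h) (by omega)

/-- Justifies the truncation `k ≤ n` in `subst`: the power `b ^ k` starts at index `2 ^ k > k`. -/
lemma logExp_mul_pow_apply_eq_zero (w : ℝ) (c : ArithmeticFunction ℂ) {b : ArithmeticFunction ℂ}
    (hb : b 1 = 0) {k n : ℕ} (hn : n < k) : (logExp w c k * b ^ k) n = 0 := by
  rw [ArithmeticFunction.mul_apply]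
  refine Finset.sum_eq_zero fun p hp => ?_
  rw [pow_apply_eq_zero hb, mul_zero]
  have := Nat.divisor_le (Nat.snd_mem_divisors_of_mem_antidiagonal hp)
  exact (this.trans_lt hn).trans k.lt_two_pow_self

lemma mul_nonneg_apply {a b : ArithmeticFunction ℂ} (ha : ∀ n, 0 ≤ a n) (hb : ∀ n, 0 ≤ b n)
    (n : ℕ) : 0 ≤ (a * b) n := by
  rw [ArithmeticFunction.mul_apply]
  exact Finset.sum_nonneg fun p _ => mul_nonneg (ha _) (hb _)

lemma pow_nonneg_apply {b : ArithmeticFunction ℂ} (hb : ∀ n, 0 ≤ b n) (k n : ℕ) :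
    0 ≤ (b ^ k) n := by
  induction k generalizing n with
  | zero => rw [pow_zero, ArithmeticFunction.one_apply]; split_ifs <;> simp
  | succ k ih => rw [pow_succ]; exact mul_nonneg_apply ih hb n

lemma logExp_nonneg {w : ℝ} (hw : 0 < w) {c : ArithmeticFunction ℂ} (hc : ∀ n, 0 ≤ c n)
    (k n : ℕ) : 0 ≤ logExp w c k n := by
  rw [logExp_apply]
  have := Real.log_natCast_nonneg n
  refine mul_nonneg ?_ (hc n)
  rw [Complex.zero_le_real]
  positivity

lemma subst_nonneg {w : ℝ} (hw : 0 < w) {c b : ArithmeticFunction ℂ} (hc : ∀ n, 0 ≤ c n)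
    (hb : ∀ n, 0 ≤ b n) (n : ℕ) : 0 ≤ subst w c b n :=
  Finset.sum_nonneg fun k _ =>
    mul_nonneg_apply (logExp_nonneg hw hc k) (pow_nonneg_apply hb k) n

/-! ### The `ℓ¹` norm of a Dirichlet series at a point -/

/-- The sum of the absolute values of the terms of a Dirichlet series. -/
noncomputable def lnorm (a : ℕ → ℂ) (s : ℂ) : ℝ≥0∞ := ∑' n, ‖LSeries.term a s n‖ₑ

lemma lnorm_ne_top_iff {a : ℕ → ℂ} {s : ℂ} : lnorm a s ≠ ⊤ ↔ LSeriesSummable a s := by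
  rw [lnorm, tsum_enorm_ne_top_iff_summable_norm, summable_norm_iff, LSeriesSummable]

lemma enorm_LSeries_le (a : ℕ → ℂ) (s : ℂ) : ‖LSeries a s‖ₑ ≤ lnorm a s :=
  enorm_tsum_le_tsum_enorm

lemma lnorm_anti (a : ℕ → ℂ) {s t : ℂ} (h : s.re ≤ t.re) : lnorm a t ≤ lnorm a s :=
  ENNReal.tsum_le_tsum fun n =>
    enorm_le_iff_norm_le.2 (LSeries.norm_term_le_of_re_le_re a h n)

lemma enorm_sum_of_nonneg {ι : Type*} (t : Finset ι) {z : ι → ℂ} (hz : ∀ i, 0 ≤ z i) :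
    ‖∑ i ∈ t, z i‖ₑ = ∑ i ∈ t, ‖z i‖ₑ := by
  have key : ∀ u : ℂ, 0 ≤ u → ‖u‖ₑ = ENNReal.ofReal u.re := fun u hu => by
    rw [← ofReal_norm, Complex.norm_def, Complex.normSq_apply,
      ← (Complex.nonneg_iff.1 hu).2, mul_zero, add_zero,
      Real.sqrt_mul_self (Complex.nonneg_iff.1 hu).1]
  rw [key _ (Finset.sum_nonneg fun i _ => hz i), Complex.re_sum,
    ENNReal.ofReal_sum_of_nonneg fun i _ => (Complex.nonneg_iff.1 (hz i)).1]
  exact Finset.sum_congr rfl fun i _ => (key _ (hz i)).symm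

lemma term_mul_apply (a b : ArithmeticFunction ℂ) (s : ℂ) (n : ℕ) :
    LSeries.term (a * b : ArithmeticFunction ℂ) s n =
      ∑ p ∈ n.divisorsAntidiagonal, LSeries.term a s p.1 * LSeries.term b s p.2 := by
  rw [← LSeries.term_convolution, ArithmeticFunction.coe_mul]

/-- Pairs are grouped by their product. The fibre over `0` is infinite while
`Nat.divisorsAntidiagonal 0` is empty, hence the vanishing at `0`. -/
lemma tsum_sum_divisorsAntidiagonal {x y : ℕ → ℝ≥0∞} (hx : x 0 = 0) (hy : y 0 = 0) :
    ∑' n : ℕ, ∑ p ∈ n.divisorsAntidiagonal, x p.1 * y p.2 = (∑' n, x n) * ∑' n, y n := by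
  have h := ENNReal.tsum_fiberwise (fun p : ℕ × ℕ => x p.1 * y p.2) (fun p => p.1 * p.2)
  rw [ENNReal.tsum_prod (f := fun m n => x m * y n)] at h
  simp_rw [ENNReal.tsum_mul_left, ENNReal.tsum_mul_right] at h
  rw [← h]
  refine tsum_congr fun n => ?_
  rcases eq_or_ne n 0 with rfl | hn
  · rw [Nat.divisorsAntidiagonal_zero, Finset.sum_empty, eq_comm, ENNReal.tsum_eq_zero]
    rintro ⟨p, hp⟩
    rcases mul_eq_zero.1 (show p.1 * p.2 = 0 from hp) with h | h <;> simp [h, hx, hy]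
  · rw [show (fun p : ℕ × ℕ => p.1 * p.2) ⁻¹' {n} = n.divisorsAntidiagonal by ext; simp [hn],
      Finset.tsum_subtype' n.divisorsAntidiagonal fun p => x p.1 * y p.2]

lemma lnorm_mul_le (a b : ArithmeticFunction ℂ) (s : ℂ) :
    lnorm (a * b : ArithmeticFunction ℂ) s ≤ lnorm a s * lnorm b s := by
  rw [lnorm, lnorm, lnorm, ← tsum_sum_divisorsAntidiagonal (by simp) (by simp)]
  refine ENNReal.tsum_le_tsum fun n => ?_
  rw [term_mul_apply]
  exact (enorm_sum_le _ _).trans (Finset.sum_le_sum fun p _ => (enorm_mul _ _).le)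

lemma lnorm_mul_of_nonneg {a b : ArithmeticFunction ℂ} (ha : ∀ n, 0 ≤ a n) (hb : ∀ n, 0 ≤ b n)
    (s : ℝ) : lnorm (a * b : ArithmeticFunction ℂ) s = lnorm a s * lnorm b s := by
  rw [lnorm, lnorm, lnorm, ← tsum_sum_divisorsAntidiagonal (by simp) (by simp)]
  refine tsum_congr fun n => ?_
  rw [term_mul_apply, enorm_sum_of_nonneg]
  · simp_rw [enorm_mul]
  · exact fun p => mul_nonneg (LSeries.term_nonneg (ha _) s) (LSeries.term_nonneg (hb _) s)

lemma lnorm_one (s : ℂ) : lnorm (1 : ArithmeticFunction ℂ) s = 1 := by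
  rw [lnorm, tsum_eq_single 1]
  · simp [LSeries.term_of_ne_zero]
  · intro n hn
    rcases eq_or_ne n 0 with rfl | h0
    · simp
    · simp [LSeries.term_of_ne_zero h0, ArithmeticFunction.one_apply_ne hn]

lemma lnorm_pow_le (b : ArithmeticFunction ℂ) (s : ℂ) (k : ℕ) :
    lnorm (b ^ k : ArithmeticFunction ℂ) s ≤ lnorm b s ^ k := by
  induction k with
  | zero => rw [pow_zero, pow_zero, lnorm_one]
  | succ k ih => rw [pow_succ, pow_succ]; exact (lnorm_mul_le _ _ _).trans (by gcongr)

lemma lnorm_pow_of_nonneg {b : ArithmeticFunction ℂ} (hb : ∀ n, 0 ≤ b n) (s : ℝ) (k : ℕ) :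
    lnorm (b ^ k : ArithmeticFunction ℂ) s = lnorm b s ^ k := by
  induction k with
  | zero => rw [pow_zero, pow_zero, lnorm_one]
  | succ k ih =>
    rw [pow_succ, pow_succ, lnorm_mul_of_nonneg (pow_nonneg_apply hb k) hb, ih]

/-! ### Expansion of `f (s - w z)` in powers of `z`. -/

lemma term_logExp (w : ℝ) (c : ArithmeticFunction ℂ) (k : ℕ) (s : ℂ) (n : ℕ) :
    LSeries.term (logExp w c k) s n =
      (((w * Real.log n) ^ k / k.factorial : ℝ) : ℂ) * LSeries.term c s n := by
  rcases eq_or_ne n 0 with rfl | hn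
  · simp
  · rw [LSeries.term_of_ne_zero hn, LSeries.term_of_ne_zero hn, logExp_apply, mul_div_assoc]

lemma hasSum_term_logExp (w : ℝ) (c : ArithmeticFunction ℂ) (s z : ℂ) (n : ℕ) :
    HasSum (fun k => LSeries.term (logExp w c k) s n * z ^ k) (LSeries.term c (s - w * z) n) := by
  rcases eq_or_ne n 0 with rfl | hn
  · simp [hasSum_zero]
  have h := (NormedSpace.expSeries_div_hasSum_exp
    ((w * Real.log n : ℝ) * z : ℂ)).mul_left (LSeries.term c s n)
  have hn' : (n : ℂ) ≠ 0 := Nat.cast_ne_zero.2 hn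
  convert! h using 1
  · ext k
    rw [term_logExp]
    push_cast
    ring
  · rw [LSeries.term_of_ne_zero hn, LSeries.term_of_ne_zero hn, Complex.cpow_sub _ _ hn',
      ← Complex.exp_eq_exp_ℂ, div_div_eq_mul_div, Complex.cpow_def_of_ne_zero hn' (w * z),
      ← Complex.natCast_log]
    rw [div_mul_eq_mul_div]
    push_cast
    ring_nf

/-- Shifting by `w β` multiplies the `n`-th term by `exp (w β log n)`, whose expansion has
nonnegative terms, so Tonelli applies. -/
lemma tsum_lnorm_logExp {w : ℝ} (hw : 0 < w) (c : ArithmeticFunction ℂ) (s : ℂ) {β : ℝ}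
    (hβ : 0 ≤ β) :
    ∑' k, lnorm (logExp w c k) s * ENNReal.ofReal β ^ k = lnorm c (s - w * β) := by
  simp_rw [lnorm, ← ENNReal.tsum_mul_right]
  rw [ENNReal.tsum_comm]
  refine tsum_congr fun n => ?_
  have hL := Real.log_natCast_nonneg n
  have h := NormedSpace.expSeries_div_hasSum_exp (w * Real.log n * β)
  have e1 : ∀ k : ℕ, ‖LSeries.term (logExp w c k) s n‖ₑ * ENNReal.ofReal β ^ k =
      ‖LSeries.term c s n‖ₑ * ENNReal.ofReal ((w * Real.log n * β) ^ k / k.factorial) := by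
    intro k
    have h0 : 0 ≤ (w * Real.log n) ^ k / k.factorial := by positivity
    rw [term_logExp, enorm_mul, ← ofReal_norm, Complex.norm_real,
      Real.norm_of_nonneg h0, ← ENNReal.ofReal_pow hβ, mul_right_comm, ← ENNReal.ofReal_mul h0,
      mul_comm, mul_pow (w * Real.log n)]
    ring_nf
  simp_rw [e1]
  rw [ENNReal.tsum_mul_left, ← ENNReal.ofReal_tsum_of_nonneg (fun k => by positivity) h.summable,
    h.tsum_eq, ← (hasSum_term_logExp w c s β n).tsum_eq, ← ofReal_norm,
    ← ofReal_norm, ← ENNReal.ofReal_mul (norm_nonneg _)]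
  congr 1
  have e2 : ∀ k : ℕ, LSeries.term (logExp w c k) s n * (β : ℂ) ^ k =
      LSeries.term c s n * (((w * Real.log n * β) ^ k / k.factorial : ℝ) : ℂ) := by
    intro k
    rw [term_logExp]
    push_cast
    ring
  simp_rw [e2]
  rw [tsum_mul_left, ← Complex.ofReal_tsum, h.tsum_eq, norm_mul, Complex.norm_real,
    Real.norm_of_nonneg]
  rw [← Real.exp_eq_exp_ℝ]
  positivity

lemma term_subst (w : ℝ) (c b : ArithmeticFunction ℂ) (s : ℂ) (n : ℕ) :
    LSeries.term (subst w c b) s n =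
      ∑ k ∈ Finset.range (n + 1), LSeries.term (logExp w c k * b ^ k : ArithmeticFunction ℂ) s n := by
  rcases eq_or_ne n 0 with rfl | hn
  · simp
  · simp_rw [LSeries.term_of_ne_zero hn]
    rw [subst_apply, Finset.sum_div]

lemma term_logExp_mul_pow_eq_zero (w : ℝ) (c : ArithmeticFunction ℂ) {b : ArithmeticFunction ℂ}
    (hb : b 1 = 0) (s : ℂ) {k n : ℕ} (hk : k ∉ Finset.range (n + 1)) :
    LSeries.term (logExp w c k * b ^ k : ArithmeticFunction ℂ) s n = 0 := by
  rcases eq_or_ne n 0 with rfl | hn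
  · simp
  · rw [LSeries.term_of_ne_zero hn, logExp_mul_pow_apply_eq_zero w c hb, zero_div]
    simpa using hk

lemma tsum_lnorm_logExp_mul_pow_le {w : ℝ} (hw : 0 < w) (c b : ArithmeticFunction ℂ) {s : ℂ}
    {β : ℝ} (hβ : 0 ≤ β) (h : lnorm b s ≤ ENNReal.ofReal β) :
    ∑' k, lnorm (logExp w c k * b ^ k : ArithmeticFunction ℂ) s ≤ lnorm c (s - w * β) := by
  rw [← tsum_lnorm_logExp hw c s hβ]
  refine ENNReal.tsum_le_tsum fun k => (lnorm_mul_le _ _ _).trans ?_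
  gcongr
  exact (lnorm_pow_le b s k).trans (by gcongr)

/-- For nonnegative coefficients the substitution identity holds in `[0, ∞]`. -/
theorem lnorm_subst_of_nonneg {w : ℝ} (hw : 0 < w) {c b : ArithmeticFunction ℂ}
    (hc : ∀ n, 0 ≤ c n) (hb : ∀ n, 0 ≤ b n) (hb1 : b 1 = 0) {s β : ℝ} (hβ : 0 ≤ β)
    (h : lnorm b s = ENNReal.ofReal β) :
    lnorm (subst w c b) s = lnorm c ((s - w * β : ℝ) : ℂ) := by
  push_cast
  rw [← tsum_lnorm_logExp hw c s hβ, ← h]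
  simp_rw [← lnorm_pow_of_nonneg hb,
    ← lnorm_mul_of_nonneg (logExp_nonneg hw hc _) (pow_nonneg_apply hb _)]
  rw [lnorm]
  simp_rw [lnorm]
  rw [ENNReal.tsum_comm]
  refine tsum_congr fun n => ?_
  rw [term_subst, enorm_sum_of_nonneg, tsum_eq_sum]
  · intro k hk
    rw [term_logExp_mul_pow_eq_zero w c hb1 _ hk, enorm_zero]
  · exact fun k => LSeries.term_nonneg
      (mul_nonneg_apply (logExp_nonneg hw hc k) (pow_nonneg_apply hb k) n) s

lemma LSeriesSummable_pow {b : ArithmeticFunction ℂ} {s : ℂ} (hb : LSeriesSummable b s) (k : ℕ) :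
    LSeriesSummable (b ^ k : ArithmeticFunction ℂ) s := by
  rw [← lnorm_ne_top_iff] at hb ⊢
  exact ne_top_of_le_ne_top (ENNReal.pow_ne_top hb) (lnorm_pow_le b s k)

lemma LSeries_pow {b : ArithmeticFunction ℂ} {s : ℂ} (hb : LSeriesSummable b s) (k : ℕ) :
    LSeries (b ^ k : ArithmeticFunction ℂ) s = LSeries b s ^ k := by
  induction k with
  | zero => 
    have := congrFun LSeries_delta s
    rwa [← ArithmeticFunction.one_eq_delta] at this
  | succ k ih => rw [pow_succ, pow_succ,
      ArithmeticFunction.LSeries_mul' (LSeriesSummable_pow hb k) hb, ih]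

lemma summable_uncurry_of_tsum_enorm_ne_top {x : ℕ → ℕ → ℂ}
    (h : ∑' k, ∑' n, ‖x k n‖ₑ ≠ ⊤) : Summable (Function.uncurry x) := by
  refine Summable.of_enorm ?_
  rw [← ENNReal.tsum_prod] at h
  exact h

/-- The substitution identity in the half-plane where everything converges absolutely. -/
theorem LSeries_subst {w : ℝ} (hw : 0 < w) (c : ArithmeticFunction ℂ) {b : ArithmeticFunction ℂ}
    (hb1 : b 1 = 0) {s : ℂ} {β : ℝ} (hβ : 0 < β) (h : lnorm b s ≤ ENNReal.ofReal β)
    (hc : LSeriesSummable c (s - w * β)) :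
    LSeriesSummable (subst w c b) s ∧ LSeriesSummable c (s - w * LSeries b s) ∧
      LSeries c (s - w * LSeries b s) = LSeries (subst w c b) s := by
  have hbs : LSeriesSummable b s :=
    lnorm_ne_top_iff.1 (ne_top_of_le_ne_top ENNReal.ofReal_ne_top h)
  have hfin := lnorm_ne_top_iff.2 hc
  have h1 := ne_top_of_le_ne_top hfin (tsum_lnorm_logExp_mul_pow_le hw c b hβ.le h)
  have hG : ‖LSeries b s‖ₑ ≤ ENNReal.ofReal β := (enorm_LSeries_le b s).trans h
  have hk : ∀ k, LSeriesSummable (logExp w c k) s := by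
    intro k
    rw [← tsum_lnorm_logExp hw c s hβ.le] at hfin
    have := ENNReal.ne_top_of_tsum_ne_top hfin k
    rw [← lnorm_ne_top_iff]
    intro htop
    -- Strict positivity of `β` is needed here: `⊤ * 0 = 0` would hide a divergent factor.
    rw [htop, ENNReal.top_mul (pow_ne_zero _ (by simpa using hβ))] at this
    exact this rfl
  have h2 : ∑' k, ∑' n, ‖LSeries.term (logExp w c k) s n * LSeries b s ^ k‖ₑ ≠ ⊤ := by
    refine ne_top_of_le_ne_top hfin ?_
    rw [← tsum_lnorm_logExp hw c s hβ.le]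
    refine ENNReal.tsum_le_tsum fun k => ?_
    simp_rw [enorm_mul, enorm_pow]
    rw [ENNReal.tsum_mul_right]
    gcongr
    exact le_rfl
  -- Both double series, with `b ^ k` and with `LSeries b s ^ k`, converge absolutely, so each may
  -- be summed in either order.
  have s1 := summable_uncurry_of_tsum_enorm_ne_top h1
  have s2 := summable_uncurry_of_tsum_enorm_ne_top h2
  have e1 : ∀ n, ∑' k, LSeries.term (logExp w c k * b ^ k : ArithmeticFunction ℂ) s n =
      LSeries.term (subst w c b) s n := by
    intro n
    rw [term_subst, tsum_eq_sum]
    exact fun k hk => term_logExp_mul_pow_eq_zero w c hb1 _ hk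
  refine ⟨?_, ?_, ?_⟩
  · rw [← lnorm_ne_top_iff]
    refine ne_top_of_le_ne_top h1 ?_
    rw [lnorm]
    simp_rw [lnorm]
    rw [ENNReal.tsum_comm]
    refine ENNReal.tsum_le_tsum fun n => ?_
    rw [← e1]
    exact enorm_tsum_le_tsum_enorm
  · refine hc.of_re_le_re ?_
    have h3 : ‖LSeries b s‖ ≤ β := by
      rwa [← ofReal_norm, ENNReal.ofReal_le_ofReal_iff hβ.le] at hG
    have := (Complex.re_le_norm _).trans h3
    simp only [Complex.sub_re, Complex.re_ofReal_mul, Complex.ofReal_re]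
    gcongr
  · calc LSeries c (s - w * LSeries b s)
        = ∑' n, ∑' k, LSeries.term (logExp w c k) s n * LSeries b s ^ k :=
          tsum_congr fun n => (hasSum_term_logExp w c s _ n).tsum_eq.symm
      _ = ∑' k, ∑' n, LSeries.term (logExp w c k) s n * LSeries b s ^ k := s2.tsum_comm
      _ = ∑' k, LSeries (logExp w c k * b ^ k : ArithmeticFunction ℂ) s := by
          refine tsum_congr fun k => ?_
          rw [tsum_mul_right, ArithmeticFunction.LSeries_mul' (hk k) (LSeriesSummable_pow hbs k),
            LSeries_pow hbs]
          rfl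
      _ = ∑' n, ∑' k, LSeries.term (logExp w c k * b ^ k : ArithmeticFunction ℂ) s n :=
          s1.tsum_comm.symm
      _ = LSeries (subst w c b) s := tsum_congr e1

/-! ### The formal solution -/

lemma pow_apply_congr {b b' : ArithmeticFunction ℂ} {n : ℕ} (h : ∀ d < n, b d = b' d) (k : ℕ)
    {m : ℕ} (hm : m < n) : (b ^ k) m = (b' ^ k) m := by
  induction k generalizing m with
  | zero => simp
  | succ k ih =>
    rw [pow_succ, pow_succ, ArithmeticFunction.mul_apply, ArithmeticFunction.mul_apply]
    refine Finset.sum_congr rfl fun p hp => ?_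
    rw [ih ((Nat.divisor_le (Nat.fst_mem_divisors_of_mem_antidiagonal hp)).trans_lt hm),
      h _ ((Nat.divisor_le (Nat.snd_mem_divisors_of_mem_antidiagonal hp)).trans_lt hm)]

/-- Only divisors `p.1 ≥ 2` contribute since `c 1 = 0`, so the cofactor `p.2` is smaller than `n`.
-/
lemma subst_apply_congr (w : ℝ) {c : ArithmeticFunction ℂ} (hc : c 1 = 0)
    {b b' : ArithmeticFunction ℂ} {n : ℕ} (h : ∀ d < n, b d = b' d) :
    subst w c b n = subst w c b' n := by
  rw [subst_apply, subst_apply]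
  refine Finset.sum_congr rfl fun k _ => ?_
  rw [ArithmeticFunction.mul_apply, ArithmeticFunction.mul_apply]
  refine Finset.sum_congr rfl fun p hp => ?_
  obtain ⟨hp, hn⟩ := Nat.mem_divisorsAntidiagonal.1 hp
  rcases Nat.lt_or_ge p.1 2 with h2 | h2
  · rw [show logExp w c k p.1 = 0 by rw [logExp_apply]; interval_cases p.1 <;> simp [hc],
      zero_mul, zero_mul]
  · rw [pow_apply_congr h]
    have : 0 < p.2 := Nat.pos_of_ne_zero fun h0 => hn (by rw [← hp, h0, mul_zero])
    nlinarith

lemma subst_apply_one (w : ℝ) {c : ArithmeticFunction ℂ} (hc : c 1 = 0)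
    (b : ArithmeticFunction ℂ) : subst w c b 1 = 0 := by
  rw [subst_apply]
  exact Finset.sum_eq_zero fun k _ => by
    rw [ArithmeticFunction.mul_apply_one, logExp_apply, hc, mul_zero, zero_mul]

lemma eq_of_subst_eq_self (w : ℝ) {c : ArithmeticFunction ℂ} (hc : c 1 = 0)
    {b b' : ArithmeticFunction ℂ} (hb : subst w c b = b) (hb' : subst w c b' = b') : b = b' := by
  ext n
  induction n using Nat.strong_induction_on with
  | _ n ih => rw [← hb, ← hb', subst_apply_congr w hc ih]

/-- The iterates, started at zero, of the map of which the formal solution is the fixed point. -/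
noncomputable def iter (w : ℝ) (c : ArithmeticFunction ℂ) (j : ℕ) : ArithmeticFunction ℂ :=
  (subst w c)^[j] 0

lemma iter_succ (w : ℝ) (c : ArithmeticFunction ℂ) (j : ℕ) :
    iter w c (j + 1) = subst w c (iter w c j) := Function.iterate_succ_apply' _ _ _

lemma iter_succ_apply (w : ℝ) {c : ArithmeticFunction ℂ} (hc : c 1 = 0) (j : ℕ) {n : ℕ}
    (hn : n ≤ j) : iter w c (j + 1) n = iter w c j n := by
  induction j generalizing n with
  | zero => obtain rfl : n = 0 := by omega
            simp
  | succ j ih =>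
    have := subst_apply_congr w hc (b := iter w c (j + 1)) (b' := iter w c j) (n := n)
      fun d hd => ih (by omega)
    rwa [← iter_succ, ← iter_succ] at this

lemma iter_apply_of_le (w : ℝ) {c : ArithmeticFunction ℂ} (hc : c 1 = 0) {n j : ℕ}
    (hn : n ≤ j) : iter w c j n = iter w c n n := by
  induction j, hn using Nat.le_induction with
  | base => rfl
  | succ j hj ih => rw [iter_succ_apply w hc j hj, ih]

/-- The coefficients of the Dirichlet series solving `f (s - w g(s)) = g(s)`. -/
noncomputable def solution (w : ℝ) (c : ArithmeticFunction ℂ) : ArithmeticFunction ℂ :=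
  ⟨fun n => iter w c n n, by simp⟩

lemma solution_apply_of_le (w : ℝ) {c : ArithmeticFunction ℂ} (hc : c 1 = 0) {n j : ℕ}
    (hn : n ≤ j) : solution w c n = iter w c j n := (iter_apply_of_le w hc hn).symm

lemma subst_solution (w : ℝ) {c : ArithmeticFunction ℂ} (hc : c 1 = 0) :
    subst w c (solution w c) = solution w c := by
  ext n
  rw [subst_apply_congr w hc (b' := iter w c n) fun d hd => solution_apply_of_le w hc hd.le,
    ← iter_succ, iter_succ_apply w hc n le_rfl, solution_apply_of_le w hc le_rfl]

lemma iter_nonneg {w : ℝ} (hw : 0 < w) {c : ArithmeticFunction ℂ} (hc : ∀ n, 0 ≤ c n)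
    (j n : ℕ) : 0 ≤ iter w c j n := by
  induction j generalizing n with
  | zero => simp [iter]
  | succ j ih => rw [iter_succ]; exact subst_nonneg hw hc ih n

lemma iter_apply_one (w : ℝ) {c : ArithmeticFunction ℂ} (hc : c 1 = 0) (j : ℕ) :
    iter w c j 1 = 0 := by
  cases j with
  | zero => simp [iter]
  | succ j => rw [iter_succ]; exact subst_apply_one w hc _

lemma solution_nonneg {w : ℝ} (hw : 0 < w) {c : ArithmeticFunction ℂ} (hc : ∀ n, 0 ≤ c n)
    (n : ℕ) : 0 ≤ solution w c n := iter_nonneg hw hc n n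

/-! ### The abscissa of absolute convergence of the solution -/

lemma lnorm_eq_ofReal_realSum {c : ArithmeticFunction ℂ} (hc : ∀ n, 0 ≤ c n) {s : ℝ}
    (hs : LSeriesSummable c s) : lnorm c s = ENNReal.ofReal (realSum c s) := by
  have h : HasSum (fun n => (LSeries.term c s n).re) (realSum c s) := Complex.hasSum_re hs.hasSum
  have h0 : ∀ n, 0 ≤ LSeries.term c s n := fun n => LSeries.term_nonneg (hc n) s
  rw [← h.tsum_eq, ENNReal.ofReal_tsum_of_nonneg (fun n => (Complex.nonneg_iff.1 (h0 n)).1)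
    h.summable]
  refine tsum_congr fun n => ?_
  rw [← ofReal_norm, Complex.norm_def, Complex.normSq_apply,
    ← (Complex.nonneg_iff.1 (h0 n)).2, mul_zero, add_zero,
    Real.sqrt_mul_self (Complex.nonneg_iff.1 (h0 n)).1]

lemma realSum_nonneg {c : ArithmeticFunction ℂ} (hc : ∀ n, 0 ≤ c n) (s : ℝ) :
    0 ≤ realSum c s := by
  have : 0 ≤ LSeries c s := tsum_nonneg fun n => LSeries.term_nonneg (hc n) s
  exact (Complex.nonneg_iff.1 this).1

/-- If an iterate has norm `β ≤ f(u)` at `s = u + w f(u)`, then `s - w β ≥ u`, so the next one has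
norm `f (s - w β) ≤ f(u)`. -/
lemma lnorm_iter_le {w : ℝ} (hw : 0 < w) {c : ArithmeticFunction ℂ} (hc1 : c 1 = 0)
    (hc : ∀ n, 0 ≤ c n) {u : ℝ} (hu : LSeriesSummable c u) (j : ℕ) :
    lnorm (iter w c j) ((u + w * realSum c u : ℝ) : ℂ) ≤ ENNReal.ofReal (realSum c u) := by
  induction j with
  | zero => simp [iter, lnorm, LSeries.term_def]
  | succ j ih =>
    have hfin := ne_top_of_le_ne_top ENNReal.ofReal_ne_top ih
    rw [iter_succ, lnorm_subst_of_nonneg hw hc (iter_nonneg hw hc j) (iter_apply_one w hc1 j)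
      ENNReal.toReal_nonneg (ENNReal.ofReal_toReal hfin).symm, ← lnorm_eq_ofReal_realSum hc hu]
    refine lnorm_anti _ ?_
    have := ENNReal.toReal_le_of_le_ofReal (realSum_nonneg hc u) ih
    simp only [Complex.ofReal_re]
    nlinarith

lemma LSeriesSummable_solution {w : ℝ} (hw : 0 < w) {c : ArithmeticFunction ℂ} (hc1 : c 1 = 0)
    (hc : ∀ n, 0 ≤ c n) {u : ℝ} (hu : LSeriesSummable c u) :
    LSeriesSummable (solution w c) ((u + w * realSum c u : ℝ) : ℂ) := by
  rw [← lnorm_ne_top_iff]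
  refine ne_top_of_le_ne_top (ENNReal.ofReal_ne_top (r := realSum c u)) ?_
  rw [lnorm, ENNReal.tsum_eq_iSup_nat]
  -- The terms below `N` agree with those of the `N`-th iterate, so the uniform bound on iterates
  -- passes to partial sums.
  refine iSup_le fun N => le_trans ?_ (lnorm_iter_le hw hc1 hc hu N)
  refine le_trans (Finset.sum_le_sum fun n hn => le_of_eq ?_) (ENNReal.sum_le_tsum (Finset.range N))
  rw [LSeries.term_def, LSeries.term_def,
    solution_apply_of_le w hc1 (Finset.mem_range.1 hn).le]

/-- The witness is `u = s - w g(s)`: finiteness of `g(s) = f(u)` in `[0, ∞]` already forces `f` to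
converge at `u`. -/
lemma exists_of_LSeriesSummable_solution {w : ℝ} (hw : 0 < w) {c : ArithmeticFunction ℂ}
    (hc1 : c 1 = 0) (hc : ∀ n, 0 ≤ c n) {s : ℝ} (hs : LSeriesSummable (solution w c) s) :
    ∃ u : ℝ, LSeriesSummable c u ∧ u + w * realSum c u = s := by
  have hb := solution_nonneg hw hc
  have hb1 : solution w c 1 = 0 := by rw [← subst_solution w hc1]; exact subst_apply_one w hc1 _
  have h := lnorm_eq_ofReal_realSum hb hs
  have h2 := lnorm_subst_of_nonneg hw hc hb hb1 (realSum_nonneg hb s) h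
  rw [subst_solution w hc1, h] at h2
  have h3 := lnorm_ne_top_iff.1 (h2 ▸ ENNReal.ofReal_ne_top)
  rw [lnorm_eq_ofReal_realSum hc h3, ENNReal.ofReal_eq_ofReal_iff (realSum_nonneg hb _)
    (realSum_nonneg hc _)] at h2
  exact ⟨_, h3, by rw [← h2]; ring⟩

/-- The abscissa of the solution is the least value of `s + w f(s)`, once this value is attained. -/
lemma abscissaOfAbsConv_solution {w : ℝ} (hw : 0 < w) {c : ArithmeticFunction ℂ} (hc1 : c 1 = 0)
    (hc : ∀ n, 0 ≤ c n) {p : ℝ} (hp : LSeriesSummable c p)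
    (hmin : ∀ u : ℝ, LSeriesSummable c u → p + w * realSum c p ≤ u + w * realSum c u) :
    LSeries.abscissaOfAbsConv (solution w c) = ((p + w * realSum c p : ℝ) : EReal) := by
  refine le_antisymm ?_ ?_
  · simpa only [Complex.ofReal_re] using
      (LSeriesSummable_solution hw hc1 hc hp).abscissaOfAbsConv_le
  · refine EReal.le_of_forall_lt_iff_le.1 fun s hs => ?_
    obtain ⟨u, hu, rfl⟩ := exists_of_LSeriesSummable_solution hw hc1 hc
      (LSeriesSummable_of_abscissaOfAbsConv_lt_re (s := (s : ℂ)) (by simpa using hs))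
    exact EReal.coe_le_coe_iff.2 (hmin u hu)

/-! ### Existence and uniqueness -/

lemma exists_LSeries_subst {w : ℝ} (hw : 0 < w) {c b : ArithmeticFunction ℂ}
    (hc : LSeries.abscissaOfAbsConv c < ⊤) (hb1 : b 1 = 0)
    (hb : LSeries.abscissaOfAbsConv b < ⊤) :
    ∃ θ : ℝ, ∀ s : ℂ, θ < s.re → LSeriesSummable b s ∧ LSeriesSummable (subst w c b) s ∧
      LSeriesSummable c (s - w * LSeries b s) ∧
      LSeries c (s - w * LSeries b s) = LSeries (subst w c b) s := by
  obtain ⟨x, hx, -⟩ := EReal.exists_between_coe_real hc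
  obtain ⟨y, hy, -⟩ := EReal.exists_between_coe_real hb
  have hbs : LSeriesSummable b (y : ℂ) :=
    LSeriesSummable_of_abscissaOfAbsConv_lt_re (by simpa using hy)
  set β := (lnorm b y).toReal + 1
  have hβ : 0 < β := by positivity
  have hle : lnorm b y ≤ ENNReal.ofReal β := by
    rw [← ENNReal.ofReal_toReal (lnorm_ne_top_iff.2 hbs)]
    exact ENNReal.ofReal_le_ofReal (by simp [β])
  -- Right of `y` the norm of `b` stays below `β`; right of `x + w β` the point `s - w β` stays
  -- where `c` converges.
  refine ⟨max y (x + w * β), fun s hs => ?_⟩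
  obtain ⟨h1, h2⟩ := max_lt_iff.1 hs
  refine ⟨hbs.of_re_le_re (by simpa using h1.le), LSeries_subst hw c hb1 hβ
    ((lnorm_anti b (by simpa using h1.le)).trans hle)
    (LSeriesSummable_of_abscissaOfAbsConv_lt_re (hx.trans ?_))⟩
  simp only [Complex.sub_re, Complex.re_ofReal_mul, Complex.ofReal_re, EReal.coe_lt_coe_iff]
  linarith

lemma eq_solution {f g : ArithmeticFunction ℂ} {w : ℝ} (hw : 0 < w) (hf : IsDirichletD0 f)
    (hg : SolvesInversion f w g) : g = solution w f := by
  refine eq_of_subst_eq_self w hf.one_eq_zero ?_ (subst_solution w hf.one_eq_zero)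
  obtain ⟨θ, hθ⟩ := hg.eqn
  obtain ⟨θ', hθ'⟩ := exists_LSeries_subst hw hf.abscissa_lt_top hg.mem.one_eq_zero
    hg.mem.abscissa_lt_top
  have hlt : LSeries.abscissaOfAbsConv (subst w f g) < ⊤ :=
    (hθ' ((θ' + 1 : ℝ) : ℂ) (by simp)).2.1.abscissaOfAbsConv_le.trans_lt (EReal.coe_lt_top _)
  ext n
  rcases eq_or_ne n 0 with rfl | hn
  · simp
  refine LSeries.eq_of_LSeries_eventually_eq hlt hg.mem.abscissa_lt_top ?_ hn
  filter_upwards [eventually_gt_atTop θ, eventually_gt_atTop θ'] with s h1 h2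
  rw [← (hθ' s (by simpa using h2)).2.2.2, (hθ s (by simpa using h1)).2.2]

lemma solvesInversion_solution {f : ArithmeticFunction ℂ} {w : ℝ} (hw : 0 < w)
    (hf : IsDirichletD0 f) (hf0 : ∀ n, 0 ≤ f n) : SolvesInversion f w (solution w f) := by
  have h1 : solution w f 1 = 0 := by
    rw [← subst_solution w hf.one_eq_zero]; exact subst_apply_one w hf.one_eq_zero _
  obtain ⟨u, hu, -⟩ := EReal.exists_between_coe_real hf.abscissa_lt_top
  have hfin : LSeries.abscissaOfAbsConv (solution w f) < ⊤ :=
    (LSeriesSummable_solution hw hf.one_eq_zero hf0 (u := u)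
      (LSeriesSummable_of_abscissaOfAbsConv_lt_re (by simpa using hu))).abscissaOfAbsConv_le.trans_lt
      (EReal.coe_lt_top _)
  refine ⟨⟨h1, hfin⟩, ?_⟩
  obtain ⟨θ, hθ⟩ := exists_LSeries_subst hw hf.abscissa_lt_top h1 hfin
  refine ⟨θ, fun s hs => ?_⟩
  obtain ⟨h2, -, h3, h4⟩ := hθ s hs
  rw [subst_solution w hf.one_eq_zero] at h4
  exact ⟨h2, h3, h4⟩

/-! ### Dirichlet series with nonnegative coefficients on the real axis -/

section RealAxis

variable {f : ArithmeticFunction ℂ}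

lemma term_eq_ofReal (hf : ∀ n, 0 ≤ f n) (s : ℝ) (n : ℕ) :
    LSeries.term f s n = (((f n).re * Real.exp (-(s * Real.log n)) : ℝ) : ℂ) := by
  rcases eq_or_ne n 0 with rfl | hn
  · simp
  have hre : f n = ((f n).re : ℂ) := by
    apply Complex.ext
    · simp
    · simp [← (Complex.nonneg_iff.1 (hf n)).2]
  rw [LSeries.term_of_ne_zero hn, Complex.cpow_def_of_ne_zero (Nat.cast_ne_zero.2 hn),
    ← Complex.natCast_log, div_eq_mul_inv, ← Complex.exp_neg]
  nth_rewrite 1 [hre]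
  push_cast
  ring_nf

lemma LSeriesSummable_iff_summable_exp (hf : ∀ n, 0 ≤ f n) (s : ℝ) :
    LSeriesSummable f s ↔ Summable fun n : ℕ => (f n).re * Real.exp (-(s * Real.log n)) := by
  rw [LSeriesSummable, ← Complex.summable_ofReal]
  exact summable_congr fun n => term_eq_ofReal hf s n

lemma hasSum_realSum (hf : ∀ n, 0 ≤ f n) {s : ℝ} (hs : LSeriesSummable f s) :
    HasSum (fun n : ℕ => (f n).re * Real.exp (-(s * Real.log n))) (realSum f s) := by
  have h : HasSum (fun n => (LSeries.term f s n).re) (realSum f s) := Complex.hasSum_re hs.hasSum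
  simpa only [term_eq_ofReal hf, Complex.ofReal_re] using h

/-- The negative of the derivative of the sum of a Dirichlet series on the real axis. -/
noncomputable def logSum (f : ArithmeticFunction ℂ) (s : ℝ) : ℝ :=
  (LSeries (LSeries.logMul f) (s : ℂ)).re

lemma hasSum_logSum (hf : ∀ n, 0 ≤ f n) {s : ℝ} (hs : LSeries.abscissaOfAbsConv f < s) :
    HasSum (fun n : ℕ => Real.log n * ((f n).re * Real.exp (-(s * Real.log n)))) (logSum f s) := by
  have h : HasSum (fun n => (LSeries.term (LSeries.logMul f) s n).re) (logSum f s) :=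
    Complex.hasSum_re (LSeriesSummable_logMul_of_lt_re (s := (s : ℂ)) (by simpa using hs)).hasSum
  convert! h using 2 with n
  rcases eq_or_ne n 0 with rfl | hn
  · simp
  have h1 := term_eq_ofReal hf s n
  rw [LSeries.term_of_ne_zero hn] at h1 ⊢
  rw [LSeries.logMul, mul_div_assoc, h1, ← Complex.natCast_log, ← Complex.ofReal_mul,
    Complex.ofReal_re]

lemma hasDerivAt_realSum {s : ℝ} (hs : LSeries.abscissaOfAbsConv f < s) :
    HasDerivAt (realSum f) (-logSum f s) s := by
  have h := (LSeries_hasDerivAt (f := f) (s := (s : ℂ)) (by simpa using hs)).real_of_complex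
  simpa [logSum] using! h

lemma continuousOn_logSum {σ : ℝ} (hσ : LSeries.abscissaOfAbsConv f = σ) :
    ContinuousOn (logSum f) (Set.Ioi σ) := by
  intro s hs
  have hs' : LSeries.abscissaOfAbsConv (LSeries.logMul f) < ((s : ℂ)).re := by
    rw [LSeries.abscissaOfAbsConv_logMul, hσ]
    exact EReal.coe_lt_coe_iff.2 hs
  exact (LSeries_hasDerivAt hs').real_of_complex.continuousAt.continuousWithinAt

lemma coeff_re_nonneg (hf : ∀ n, 0 ≤ f n) (n : ℕ) : 0 ≤ (f n).re :=
  (Complex.nonneg_iff.1 (hf n)).1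

/-- The graph of a Dirichlet series with nonnegative coefficients lies above its tangents. -/
lemma realSum_tangent_le (hf : ∀ n, 0 ≤ f n) {s t : ℝ} (hs : LSeries.abscissaOfAbsConv f < s)
    (ht : LSeriesSummable f t) : realSum f s - logSum f s * (t - s) ≤ realSum f t := by
  have h1 := hasSum_realSum hf
    (LSeriesSummable_of_abscissaOfAbsConv_lt_re (s := (s : ℂ)) (by simpa using hs))
  refine hasSum_le (fun n => ?_) (h1.sub ((hasSum_logSum hf hs).mul_right (t - s)))
    (hasSum_realSum hf ht)
  -- Convexity, term by term: `1 + x ≤ exp x`.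
  have h2 := Real.add_one_le_exp (-((t - s) * Real.log n))
  have h3 : Real.exp (-(t * Real.log n)) =
      Real.exp (-(s * Real.log n)) * Real.exp (-((t - s) * Real.log n)) := by
    rw [← Real.exp_add]; ring_nf
  rw [h3]
  have h4 : 0 ≤ (f n).re * Real.exp (-(s * Real.log n)) :=
    mul_nonneg (coeff_re_nonneg hf n) (Real.exp_pos _).le
  nlinarith [mul_le_mul_of_nonneg_left h2 h4]

/-- The zero series has abscissa `-∞`. An index `n ≥ 2` has `log n > 0`, which makes `logSum`
strictly decreasing. -/
lemma exists_coeff_pos (hf : ∀ n, 0 ≤ f n) (hf1 : f 1 = 0) {σ : ℝ}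
    (hσ : LSeries.abscissaOfAbsConv f = σ) : ∃ n : ℕ, 2 ≤ n ∧ 0 < (f n).re := by
  by_contra! h
  have h0 : ∀ n, f n = 0 := by
    intro n
    rcases Nat.lt_or_ge n 2 with hn | hn
    · interval_cases n <;> simp [hf1]
    · exact Complex.ext (le_antisymm (h n hn) (coeff_re_nonneg hf n))
        (Complex.nonneg_iff.1 (hf n)).2.symm
  have hsum : LSeriesSummable f ((σ - 1 : ℝ) : ℂ) := by
    rw [LSeriesSummable_congr (g := 0) _ (fun {n} _ => h0 n)]
    exact LSeriesSummable_zero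
  have := hsum.abscissaOfAbsConv_le
  rw [hσ, Complex.ofReal_re, EReal.coe_le_coe_iff] at this
  linarith

lemma strictAntiOn_logSum (hf : ∀ n, 0 ≤ f n) (hf1 : f 1 = 0) {σ : ℝ}
    (hσ : LSeries.abscissaOfAbsConv f = σ) : StrictAntiOn (logSum f) (Set.Ioi σ) := by
  intro s hs t ht hst
  obtain ⟨m, hm, hpos⟩ := exists_coeff_pos hf hf1 hσ
  have hlog := fun n : ℕ => Real.log_natCast_nonneg n
  refine hasSum_lt (i := m) (fun n => ?_) ?_
    (hasSum_logSum hf (hσ ▸ EReal.coe_lt_coe_iff.2 ht))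
    (hasSum_logSum hf (hσ ▸ EReal.coe_lt_coe_iff.2 hs))
  · have := hlog n
    have := coeff_re_nonneg hf n
    dsimp only
    gcongr
  · have : 0 < Real.log m := Real.log_pos (by exact_mod_cast hm)
    gcongr

/-- If `f' ≥ -1/w` throughout, then `f` converges at its abscissa and `s + w f(s)` is least there. -/
lemma summable_and_le_of_logSum_le (hf : ∀ n, 0 ≤ f n) {σ : ℝ}
    (hσ : LSeries.abscissaOfAbsConv f = σ) {w : ℝ} (hw : 0 < w)
    (h : ∀ s, σ < s → logSum f s ≤ 1 / w) :
    LSeriesSummable f σ ∧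
      ∀ u : ℝ, LSeriesSummable f u → σ + w * realSum f σ ≤ u + w * realSum f u := by
  have habs : ∀ {s : ℝ}, σ < s → LSeries.abscissaOfAbsConv f < s :=
    fun hs => hσ ▸ EReal.coe_lt_coe_iff.2 hs
  have hsum : ∀ {s : ℝ}, σ < s → LSeriesSummable f s :=
    fun hs => LSeriesSummable_of_abscissaOfAbsConv_lt_re (by simpa using habs hs)
  have h0 : ∀ (s : ℝ) (n : ℕ), 0 ≤ (f n).re * Real.exp (-(s * Real.log n)) :=
    fun s n => mul_nonneg (coeff_re_nonneg hf n) (Real.exp_pos _).le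
  -- The tangent at `t` gives `f(t) ≤ f(u) + (u - t)/w`; letting `t ↓ σ` in finite partial sums
  -- needs no convergence at `σ`. The bound is uniform in `N`, so it yields both convergence and
  -- minimality.
  have key : ∀ u, σ < u → ∀ N : ℕ, ∑ n ∈ Finset.range N,
      (f n).re * Real.exp (-(σ * Real.log n)) ≤ realSum f u + 1 / w * (u - σ) := by
    intro u hu N
    have c1 : Continuous fun t : ℝ => ∑ n ∈ Finset.range N,
        (f n).re * Real.exp (-(t * Real.log n)) := by fun_prop
    have c2 : Continuous fun t : ℝ => realSum f u + 1 / w * (u - t) := by fun_prop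
    refine le_of_tendsto_of_tendsto (b := 𝓝[>] σ) (c1.continuousWithinAt (x := σ))
      (c2.continuousWithinAt (x := σ)) ?_
    filter_upwards [Ioo_mem_nhdsGT hu] with t ht
    have h1 := sum_le_hasSum (Finset.range N) (fun n _ => h0 t n) (hasSum_realSum hf (hsum ht.1))
    have h2 := realSum_tangent_le hf (habs ht.1) (hsum hu)
    have h3 := mul_le_mul_of_nonneg_right (h t ht.1) (sub_nonneg.2 ht.2.le)
    linarith
  have hS : LSeriesSummable f σ := (LSeriesSummable_iff_summable_exp hf σ).2 <|
    summable_of_sum_range_le (h0 σ) (key (σ + 1) (by linarith))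
  refine ⟨hS, fun u hu => ?_⟩
  have hle : σ ≤ u := by
    have := hu.abscissaOfAbsConv_le
    rwa [hσ, Complex.ofReal_re, EReal.coe_le_coe_iff] at this
  rcases hle.eq_or_lt with rfl | hlt
  · exact le_rfl
  have h1 := le_of_tendsto' (hasSum_realSum hf hS).tendsto_sum_nat (key u hlt)
  have h2 := mul_le_mul_of_nonneg_left h1 hw.le
  rw [mul_add, ← mul_assoc, mul_one_div_cancel hw.ne'] at h2
  linarith

/-- If `f'` takes a value below `-1/w`, then `f' = -1/w` has a solution, where `s + w f(s)` is
least. -/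
lemma exists_logSum_eq_and_le (hf : ∀ n, 0 ≤ f n) {σ : ℝ}
    (hσ : LSeries.abscissaOfAbsConv f = σ) {w : ℝ} (hw : 0 < w) {s₁ : ℝ} (h₁ : σ < s₁)
    (h : 1 / w < logSum f s₁) :
    ∃ s₀, σ < s₀ ∧ logSum f s₀ = 1 / w ∧
      ∀ u : ℝ, LSeriesSummable f u → s₀ + w * realSum f s₀ ≤ u + w * realSum f u := by
  have habs : ∀ {s : ℝ}, σ < s → LSeries.abscissaOfAbsConv f < s :=
    fun hs => hσ ▸ EReal.coe_lt_coe_iff.2 hs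
  have hF := realSum_nonneg hf s₁
  -- The tangent at `s₁ + d` gives `d * logSum f (s₁ + d) ≤ f(s₁)`; as `d > w f(s₁)`, this forces
  -- `logSum ≤ 1/w` there.
  set d := 1 + w * realSum f s₁ with hd
  have hd0 : 0 < d := by positivity
  have h₂ : logSum f (s₁ + d) ≤ 1 / w := by
    have h3 := realSum_tangent_le hf (s := s₁ + d) (t := s₁) (habs (by linarith))
      (LSeriesSummable_of_abscissaOfAbsConv_lt_re (by simpa using habs h₁))
    have h4 := realSum_nonneg hf (s₁ + d)
    have h5 : logSum f (s₁ + d) * d ≤ realSum f s₁ := by linarith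
    rw [le_div_iff₀ hw]
    by_contra! h6
    nlinarith
  obtain ⟨s₀, ⟨h3, -⟩, h4⟩ := intermediate_value_Icc' (by linarith : s₁ ≤ s₁ + d)
    ((continuousOn_logSum hσ).mono fun x hx => h₁.trans_le hx.1) ⟨h₂, h.le⟩
  refine ⟨s₀, h₁.trans_le h3, h4, fun u hu => ?_⟩
  -- The tangent at `s₀` has slope `-1/w`, so `u + w f(u)` lies above a horizontal line touching it
  -- at `s₀`.
  have h5 := mul_le_mul_of_nonneg_left
    (realSum_tangent_le hf (habs (h₁.trans_le h3)) hu) hw.le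
  rw [h4, mul_sub, ← mul_assoc, mul_one_div_cancel hw.ne'] at h5
  linarith

end RealAxis

/-- Points of divergence give the value `⊤` and never compete for the minimum. -/
lemma isLeast_extendedSum {f : ArithmeticFunction ℂ} {σ w p : ℝ} (hw : 0 < w) (hp : σ ≤ p)
    (hs : LSeriesSummable f p)
    (hmin : ∀ u : ℝ, LSeriesSummable f u → p + w * realSum f p ≤ u + w * realSum f u) :
    IsLeast ((fun s : ℝ => (s : EReal) + (w : EReal) * extendedSum f s) '' Set.Ici σ)
      ((p + w * realSum f p : ℝ) : EReal) := by
  refine ⟨⟨p, hp, ?_⟩, ?_⟩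
  · simp only [extendedSum, if_pos hs]
    norm_cast
  · rintro _ ⟨s, -, rfl⟩
    by_cases h : LSeriesSummable f s
    · simp only [extendedSum, if_pos h]
      exact_mod_cast hmin s h
    · simp only [extendedSum, if_neg h]
      rw [EReal.coe_mul_top_of_pos hw, EReal.coe_add_top]
      exact le_top

end DirichletInversion

/-! ### Assembly of the theorem. -/

open DirichletInversion in
theorem mainTheorem3 (f : ArithmeticFunction ℂ) (hf : IsDirichletD0 f) (hf_nonneg : ∀ n, 0 ≤ f n)
    (σ : ℝ) (hσ : LSeries.abscissaOfAbsConv f = (σ : EReal)) (w : ℝ) (hw : 0 < w) :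
    (∃! g : ArithmeticFunction ℂ, SolvesInversion f w g) ∧
    ∀ g : ArithmeticFunction ℂ, SolvesInversion f w g →
      (∀ n, 0 ≤ g n) ∧
      IsLeast ((fun s : ℝ => (s : EReal) + (w : EReal) * extendedSum f s) '' Set.Ici σ)
        (LSeries.abscissaOfAbsConv g) ∧
      ∃ L : EReal,
        Tendsto (fun s : ℝ => ((deriv (realSum f) s : ℝ) : EReal)) (𝓝[>] σ) (𝓝 L) ∧
        (L < ((-1 / w : ℝ) : EReal) →
          ∃ s₀ : ℝ, (σ < s₀ ∧ deriv (realSum f) s₀ = -1 / w) ∧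
            (∀ s : ℝ, σ < s → deriv (realSum f) s = -1 / w → s = s₀) ∧
            LSeries.abscissaOfAbsConv g = ((s₀ + w * realSum f s₀ : ℝ) : EReal)) ∧
        (((-1 / w : ℝ) : EReal) ≤ L →
          LSeriesSummable f (σ : ℂ) ∧
          LSeries.abscissaOfAbsConv g = ((σ + w * realSum f σ : ℝ) : EReal)) := by
  refine ⟨⟨solution w f, solvesInversion_solution hw hf hf_nonneg, fun g hg => eq_solution hw hf hg⟩,
    fun g hg => ?_⟩
  obtain rfl := eq_solution hw hf hg
  have hderiv : ∀ {s : ℝ}, σ < s → deriv (realSum f) s = -logSum f s := fun hs =>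
    (hasDerivAt_realSum (hσ ▸ EReal.coe_lt_coe_iff.2 hs)).deriv
  have hanti := strictAntiOn_logSum hf_nonneg hf.one_eq_zero hσ
  have hmono : MonotoneOn (fun s : ℝ => ((deriv (realSum f) s : ℝ) : EReal)) (Set.Ioi σ) := by
    intro s hs t ht hst
    rw [EReal.coe_le_coe_iff, hderiv hs, hderiv ht]
    exact neg_le_neg (hanti.antitoneOn hs ht hst)
  -- The derivative is monotone, so its right limit at `σ` is its infimum, which always exists in
  -- `EReal`.
  set L := sInf ((fun s : ℝ => ((deriv (realSum f) s : ℝ) : EReal)) '' Set.Ioi σ) with hL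
  have case1 : L < ((-1 / w : ℝ) : EReal) → ∃ s₀, σ < s₀ ∧ logSum f s₀ = 1 / w ∧
      ∀ u : ℝ, LSeriesSummable f u → s₀ + w * realSum f s₀ ≤ u + w * realSum f u := by
    intro h
    obtain ⟨_, ⟨s₁, h₁, rfl⟩, h₂⟩ := sInf_lt_iff.1 h
    rw [EReal.coe_lt_coe_iff, hderiv h₁, neg_div, neg_lt_neg_iff] at h₂
    exact exists_logSum_eq_and_le hf_nonneg hσ hw h₁ h₂
  have case2 : ((-1 / w : ℝ) : EReal) ≤ L → LSeriesSummable f σ ∧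
      ∀ u : ℝ, LSeriesSummable f u → σ + w * realSum f σ ≤ u + w * realSum f u := by
    intro h
    refine summable_and_le_of_logSum_le hf_nonneg hσ hw fun s hs => ?_
    have h1 := h.trans (sInf_le (Set.mem_image_of_mem _ hs))
    rwa [EReal.coe_le_coe_iff, hderiv hs, neg_div, neg_le_neg_iff] at h1
  have hsummable : ∀ {s : ℝ}, σ < s → LSeriesSummable f s := fun hs =>
    LSeriesSummable_of_abscissaOfAbsConv_lt_re
      (by rw [hσ, Complex.ofReal_re]; exact EReal.coe_lt_coe_iff.2 hs)
  have habs {p : ℝ} := abscissaOfAbsConv_solution (p := p) hw hf.one_eq_zero hf_nonneg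
  refine ⟨solution_nonneg hw hf_nonneg, ?_, L, ?_, fun h => ?_, fun h => ?_⟩
  · rcases lt_or_ge L ((-1 / w : ℝ) : EReal) with h | h
    · obtain ⟨s₀, h0, -, hmin⟩ := case1 h
      rw [habs (hsummable h0) hmin]
      exact isLeast_extendedSum hw h0.le (hsummable h0) hmin
    · obtain ⟨hs, hmin⟩ := case2 h
      rw [habs hs hmin]
      exact isLeast_extendedSum hw le_rfl hs hmin
  · exact hmono.tendsto_nhdsGT (OrderBot.bddBelow _)
  · obtain ⟨s₀, h0, heq, hmin⟩ := case1 h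
    refine ⟨s₀, ⟨h0, by rw [hderiv h0, heq, neg_div]⟩, fun s hs hs' => ?_,
      habs (hsummable h0) hmin⟩
    rw [hderiv hs, neg_div, neg_inj] at hs'
    exact hanti.injOn hs h0 (hs'.trans heq.symm)
  · obtain ⟨hs, hmin⟩ := case2 h
    exact ⟨hs, habs hs hmin⟩
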